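/- Let $d\ge 0$ be an integer, let $\|\cdot\|$ be a norm on $\mathbf R^d$, and put $\mathbf S_+^{d-1}=\{x\in\mathbf R_+^d : \|x\|=1\}$; assume that $\mathbf S_+^{d-1}\subseteq[0,1]^d$. Let $\alpha>0$ and let $\nu_1,\nu_2$ be finite Borel measures on $\mathbf S_+^{d-1}$ satisfying the moment constraints $$\int_{\mathbf S_+^{d-1}}u^j\,\mathrm d\nu_i(u)=1,\qquad j=1,\dots,d,\quad i=1,2.$$ For such a measure $\nu$, let $\mu_{\alpha,\nu}$ (the exponent measure) be the pushforward of $\alpha r^{-(\alpha+1)}\mathrm dr\otimes\nu$ on $(0,\infty)\times\mathbf S_+^{d-1}$ under $(r,u)\mapsto r\,u^{1/\alpha}$ (coordinatewise power), and write $Z\sim\mathcal{MS}(\alpha,\nu)$ if the random vector $Z$ has the max-stable law given by $$\mathbb P(Z\le z)=\exp\bigl(-\mu_{\alpha,\nu}([0,z]^c)\bigr),\qquad z\in(0,\infty)^d,$$ where $\le$ is the coordinatewise order. Let $Z_1\sim\mathcal{MS}(\alpha,\nu_1)$ and $Z_2\sim\mathcal{MS}(\alpha,\nu_2)$. Let $d_{TV}(\nu_1,\nu_2)=\int|f_1-f_2|\,\mathrm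 d(\nu_1+\nu_2)$, with $f_i=\mathrm d\nu_i/\mathrm d(\nu_1+\nu_2)$, be the total mass of $|\nu_1-\nu_2|$. Then: 1. With $d_K(X,Y)=\sup_{z\in(0,\infty)^d}|\mathbb P(X\le z)-\mathbb P(Y\le z)|$, $$d_K(Z_1,Z_2)\le d\; d_{TV}(\nu_1,\nu_2).$$ 2. If moreover $\alpha>1$, then $h(Z_1)$ and $h(Z_2)$ are integrable for every $h:\mathbf R_+^d\to\mathbf R$ that is $1$-Lipschitz for the norm $\|x\|_1=\sum_j|x^j|$, and, with $d_W(X,Y)=\sup_h|\mathbb E[h(X)]-\mathbb E[h(Y)]|$, the supremum being taken over all such $h$, $$d_W(Z_1,Z_2)\le d\,\Gamma\Bigl(1-\frac1\alpha\Bigr)\,d_{TV}(\nu_1,\nu_2).$$ -/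

import Mathlib

open MeasureTheory
open scoped ENNReal

noncomputable section

namespace MaxStable

/-- The positive orthant `{x ∈ ℝ₊ᵈ : N x = 1}` of the unit sphere of the reference norm `N`. -/
def posSphere {d : ℕ} (N : Seminorm ℝ (Fin d → ℝ)) : Set (Fin d → ℝ) :=
  {x | (∀ j, 0 ≤ x j) ∧ N x = 1}

/-- The assumptions on the reference norm: `N` is a norm (a definite seminorm), normalized so that
the positive orthant of its unit sphere lies in `[0,1]ᵈ`. -/
structure IsReferenceNorm {d : ℕ} (N : Seminorm ℝ (Fin d → ℝ)) : Prop where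
  definite : ∀ x, N x = 0 → x = 0
  le_one : ∀ u ∈ posSphere N, ∀ j, u j ≤ 1

/-- The moment constraints `∫ uʲ dν(u) = 1` for every coordinate `j`. -/
def MomentConstraints {d : ℕ} {N : Seminorm ℝ (Fin d → ℝ)} (ν : Measure (posSphere N)) : Prop :=
  ∀ j : Fin d, ∫ u, (u : Fin d → ℝ) j ∂ν = 1

/-- The measure `ρ_α` on `(0,∞)`, with density `α r^{-(α+1)}`, so that `ρ_α [x,∞) = x^{-α}`
for `x > 0`. -/
def radialMeasure (α : ℝ) : Measure ℝ :=
  (volume.restrict (Set.Ioi 0)).withDensity fun r => ENNReal.ofReal (α * r ^ (-(α + 1)))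

/-- The exponent measure with stability index `α` and angular measure `ν`: the pushforward of
`ρ_α ⊗ ν` under `(r, u) ↦ r u^{1/α}` (powers are taken coordinatewise). -/
def exponentMeasure {d : ℕ} {N : Seminorm ℝ (Fin d → ℝ)} (α : ℝ) (ν : Measure (posSphere N)) :
    Measure (Fin d → ℝ) :=
  ((radialMeasure α).prod ν).map fun p j => p.1 * ((p.2 : Fin d → ℝ) j) ^ (1 / α)

/-- The cumulative distribution function `F_X(z) = P(X ≤ z)`, with the coordinatewise order. -/
def cdf {Ω : Type*} [MeasurableSpace Ω] (P : Measure Ω) {d : ℕ} (X : Ω → Fin d → ℝ)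
    (z : Fin d → ℝ) : ℝ :=
  P.real {ω | ∀ j, X ω j ≤ z j}

/-- `Z ∼ MS(α, ν)`: the random vector `Z` has the max-stable law with exponent measure
`μ = exponentMeasure α ν`, that is `P(Z ≤ z) = exp (-μ([0,z]ᶜ))` for every `z ∈ (0,∞)ᵈ`.
(`μ` is carried by the nonnegative orthant, so `[0,z]ᶜ` is `{x | ¬ x ≤ z}` up to a null set; this
set has finite `μ`-mass when `α > 0` and `ν` is finite. Letting coordinates of `z` tend to `0` or
`∞`, the formula determines the law of `Z`, which is carried by `(0,∞)ᵈ` if the moment constraints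
hold.) -/
structure IsMS {Ω : Type*} [MeasurableSpace Ω] (P : Measure Ω) {d : ℕ}
    {N : Seminorm ℝ (Fin d → ℝ)} (α : ℝ) (ν : Measure (posSphere N)) (Z : Ω → Fin d → ℝ) :
    Prop where
  aemeasurable : AEMeasurable Z P
  cdf_eq : ∀ z : Fin d → ℝ, (∀ j, 0 < z j) →
    cdf P Z z = Real.exp (-(exponentMeasure α ν).real {x | ¬ ∀ j, x j ≤ z j})

/-- The Kolmogorov distance `sup_{z ∈ (0,∞)ᵈ} |F_X(z) - F_Y(z)|`. -/
def kolmogorovDist {Ω₁ Ω₂ : Type*} [MeasurableSpace Ω₁] [MeasurableSpace Ω₂]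
    (P₁ : Measure Ω₁) (P₂ : Measure Ω₂) {d : ℕ} (X : Ω₁ → Fin d → ℝ) (Y : Ω₂ → Fin d → ℝ) :
    ℝ≥0∞ :=
  ⨆ z ∈ {z : Fin d → ℝ | ∀ j, 0 < z j}, ENNReal.ofReal |cdf P₁ X z - cdf P₂ Y z|

/-- `Lip₁(ℝ₊ᵈ)`: functions that are `1`-Lipschitz on `ℝ₊ᵈ` for the `ℓ¹` norm (their values
outside `ℝ₊ᵈ` play no role for random vectors with values in `ℝ₊ᵈ`). -/
def lipOne (d : ℕ) : Set ((Fin d → ℝ) → ℝ) :=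
  {h | ∀ x y : Fin d → ℝ, (∀ j, 0 ≤ x j) → (∀ j, 0 ≤ y j) → |h x - h y| ≤ ∑ j, |x j - y j|}

/-- The Wasserstein distance `sup_{h ∈ Lip₁(ℝ₊ᵈ)} |E[h(X)] - E[h(Y)]|`, for random vectors with
values in `ℝ₊ᵈ` for which these expectations exist. -/
def wassersteinDist {Ω₁ Ω₂ : Type*} [MeasurableSpace Ω₁] [MeasurableSpace Ω₂]
    (P₁ : Measure Ω₁) (P₂ : Measure Ω₂) {d : ℕ} (X : Ω₁ → Fin d → ℝ) (Y : Ω₂ → Fin d → ℝ) :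
    ℝ≥0∞ :=
  ⨆ h ∈ lipOne d, ENNReal.ofReal |(∫ ω, h (X ω) ∂P₁) - ∫ ω, h (Y ω) ∂P₂|

/-- The total variation distance of two finite measures: the total mass of `|ν₁ - ν₂|`, that is
`∫ |f₁ - f₂| d(ν₁ + ν₂)` with `fᵢ` the density of `νᵢ` with respect to `ν₁ + ν₂`. -/
def tvDist {S : Type*} [MeasurableSpace S] (ν₁ ν₂ : Measure S) [IsFiniteMeasure ν₁]
    [IsFiniteMeasure ν₂] : ℝ≥0∞ :=
  (ν₁.toSignedMeasure - ν₂.toSignedMeasure).totalVariation Set.univ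

end MaxStable

end

/-! Split `ν₁ = w + p` and `ν₂ = w + n`, with `p`, `n` the Jordan parts of `ν₁ - ν₂`; the total
variation is the mass of `p` plus that of `n`. Exponent measures are additive in the angular
measure, so only `p` and `n` separate the two laws.

Kolmogorov: let `m` be `(min z) ^ (-α)`. The moment constraints force both exponents to be at least
`m`, while `p` and `n` contribute at most `m` times their masses. Since `exp (-x)` has slope at most
`exp (-m)` in absolute value on `[m, ∞)` and `m * exp (-m) ≤ 1`, the factor `m` disappears.

Wasserstein: couple the vectors as `W ⊔ A` and `W ⊔ B`, with `W`, `A`, `B` independent max-laws for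
`w`, `p`, `n` (`exists_coupling`). In coordinate `j`, the second exceeds the first across level `z`
only if `W` and `A` stay below `z` and `B` does not. This has probability at most `exp (-z ^ (-α)) *
z ^ (-α)` times the `j`th moment of `n`, and integrating over `z` produces the Gamma factor. As
exponent measures may be infinite near the origin, everything is raised to a level `ε`, which tends
to `0` at the end. -/

noncomputable section

namespace MaxStable

/-! ### Poisson maxima, common parts of measures, scalar estimates -/

/-- There is a law whose mass on every `S ∋ e` that is compatible with `⊔` is `exp (-μ Sᶜ)`: that of
the maximum of `e` and of a Poisson point process with intensity `μ` off `Iic e`. -/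
theorem exists_maxLaw {E : Type*} [Lattice E] [MeasurableSpace E] [MeasurableSup₂ E]
    (μ : Measure E) (e : E) (hμ : μ (Set.Iic e)ᶜ ≠ ∞) :
    ∃ Q : Measure E, IsProbabilityMeasure Q ∧ ∀ S, MeasurableSet S → e ∈ S →
      (∀ x y, x ⊔ y ∈ S ↔ x ∈ S ∧ y ∈ S) → Q S = ENNReal.ofReal (Real.exp (-μ.real Sᶜ)) := by
  set κ : Measure E := μ.restrict (Set.Iic e)ᶜ with hκ
  have : IsFiniteMeasure κ := ⟨by rw [hκ, Measure.restrict_apply_univ]; exact hμ.lt_top⟩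
  -- The unnormalized law of the maximum of `e` and `n` independent points of intensity `κ`;
  -- compatibility with `⊔` turns its mass on `S` into `κ S ^ n`.
  obtain ⟨pw, hpw0, hpws⟩ : ∃ pw : ℕ → Measure E, pw 0 = Measure.dirac e ∧
      ∀ n, pw (n + 1) = (κ.prod (pw n)).map fun x => x.1 ⊔ x.2 :=
    ⟨fun n => Nat.rec (Measure.dirac e) (fun _ R => (κ.prod R).map fun x => x.1 ⊔ x.2) n,
      rfl, fun _ => rfl⟩
  have hpwf : ∀ n, IsFiniteMeasure (pw n) := by
    intro n
    induction n with
    | zero => rw [hpw0]; infer_instance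
    | succ n ih => rw [hpws]; infer_instance
  have hpw : ∀ S, MeasurableSet S → e ∈ S → (∀ x y, x ⊔ y ∈ S ↔ x ∈ S ∧ y ∈ S) →
      ∀ n, pw n S = κ S ^ n := by
    intro S hS heS hsup n
    induction n with
    | zero =>
      simp [hpw0, Measure.dirac_apply' _ hS, heS]
    | succ n ih =>
      have := hpwf n
      rw [hpws, Measure.map_apply measurable_sup hS]
      have : (fun x : E × E => x.1 ⊔ x.2) ⁻¹' S = S ×ˢ S := by
        ext x; simp [hsup]
      rw [this, Measure.prod_prod, ih, pow_succ']
  -- Poisson mixture over the number of points: the exponential series sums the masses.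
  let Q : Measure E := Measure.sum fun n =>
    ENNReal.ofReal (Real.exp (-κ.real Set.univ) / n.factorial) • pw n
  have hQ : ∀ S, MeasurableSet S → e ∈ S → (∀ x y, x ⊔ y ∈ S ↔ x ∈ S ∧ y ∈ S) →
      Q S = ENNReal.ofReal (Real.exp (κ.real S - κ.real Set.univ)) := by
    intro S hS heS hsup
    have hs : HasSum (fun n : ℕ => Real.exp (-κ.real Set.univ) / n.factorial * κ.real S ^ n)
        (Real.exp (κ.real S - κ.real Set.univ)) := by
      have h := (NormedSpace.expSeries_div_hasSum_exp (𝔸 := ℝ) (κ.real S)).mul_left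
        (Real.exp (-κ.real Set.univ))
      rw [← Real.exp_eq_exp_ℝ, ← Real.exp_add, neg_add_eq_sub] at h
      simpa only [mul_div_assoc, div_mul_eq_mul_div] using h
    rw [Measure.sum_apply _ hS, ← hs.tsum_eq, ENNReal.ofReal_tsum_of_nonneg
      (fun n => by positivity) hs.summable]
    refine tsum_congr fun n => ?_
    rw [Measure.smul_apply, hpw S hS heS hsup, smul_eq_mul, ENNReal.ofReal_mul (by positivity),
      ENNReal.ofReal_pow (by positivity), ofReal_measureReal]
  refine ⟨Q, ⟨?_⟩, fun S hS heS hsup => ?_⟩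
  · rw [hQ _ MeasurableSet.univ trivial (by simp)]; simp
  · rw [hQ S hS heS hsup]
    congr 2
    rw [← measureReal_add_measureReal_compl hS (μ := κ)]
    -- Restricting `μ` loses nothing off `S`: if `x ≤ e` then `x ⊔ e = e ∈ S`, hence `x ∈ S`.
    have : κ.real Sᶜ = μ.real Sᶜ := by
      rw [measureReal_def, measureReal_def, hκ, Measure.restrict_apply hS.compl]
      congr 2
      rw [Set.inter_eq_left, Set.compl_subset_compl]
      intro x hx
      exact ((hsup x e).1 (by rwa [sup_eq_right.2 hx])).1
    rw [this]; ring

/-- Tonelli: the positive part of `Y - X` is the length of `[X, Y)`. -/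
theorem lintegral_ofReal_sub_eq {Ω : Type*} [MeasurableSpace Ω] (Q : Measure Ω) [SFinite Q]
    {X Y : Ω → ℝ} (hX : Measurable X) (hY : Measurable Y) :
    ∫⁻ ω, ENNReal.ofReal (Y ω - X ω) ∂Q = ∫⁻ z, Q {ω | X ω ≤ z ∧ z < Y ω} := by
  have hD : MeasurableSet {q : Ω × ℝ | X q.1 ≤ q.2 ∧ q.2 < Y q.1} :=
    (measurableSet_le (hX.comp measurable_fst) measurable_snd).inter
      (measurableSet_lt measurable_snd (hY.comp measurable_fst))
  have h1 := Measure.prod_apply (μ := Q) (ν := (volume : Measure ℝ)) hD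
  rw [Measure.prod_apply_symm hD] at h1
  refine (h1.trans (lintegral_congr fun ω => ?_)).symm
  change volume (Set.Ico (X ω) (Y ω)) = _
  rw [Real.volume_Ico]

/-- The truncated differences `ν₁ - ν₂` and `ν₂ - ν₁` are the two Jordan parts of the signed
difference; removing the first from `ν₁` leaves the common part. -/
theorem exists_common_part {S : Type*} [MeasurableSpace S] (ν₁ ν₂ : Measure S) [IsFiniteMeasure ν₁]
    [IsFiniteMeasure ν₂] : ∃ w p n : Measure S, IsFiniteMeasure w ∧ IsFiniteMeasure p ∧
      IsFiniteMeasure n ∧ ν₁ = w + p ∧ ν₂ = w + n ∧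
      tvDist ν₁ ν₂ = p Set.univ + n Set.univ := by
  have h1 : ν₁ - (ν₁ - ν₂) + (ν₁ - ν₂) = ν₁ := Measure.sub_add_cancel_of_le Measure.sub_le
  refine ⟨ν₁ - (ν₁ - ν₂), ν₁ - ν₂, ν₂ - ν₁, inferInstance, inferInstance, inferInstance, h1.symm,
    ?_, ?_⟩
  · have h := Measure.sub_toSignedMeasure_eq_toSignedMeasure_sub (μ := ν₁) (ν := ν₂)
    rw [sub_eq_sub_iff_add_eq_add, ← Measure.toSignedMeasure_add, ← Measure.toSignedMeasure_add,
      Measure.toSignedMeasure_eq_toSignedMeasure_iff] at h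
    ext s hs
    have h2 := congrArg (fun m : Measure S => m s) h
    have h3 := congrArg (fun m : Measure S => m s) h1
    simp only [Measure.add_apply] at h2 h3 ⊢
    rw [← h3, add_right_comm, add_comm ((ν₁ - ν₂) s) (ν₂ s)] at h2
    exact ((ENNReal.add_left_inj (measure_ne_top _ _)).1 h2).symm
  · rw [tvDist, SignedMeasure.totalVariation, Measure.toJordanDecomposition_toSignedMeasure_sub]
    rfl

/-- The slope bound `exp (-m)` beyond `m` absorbs the factor `m`, because `m * exp (-m) ≤ 1`. -/
theorem abs_exp_neg_sub_exp_neg_le {a b m t : ℝ} (ha : m ≤ a) (hb : m ≤ b)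
    (h : |a - b| ≤ m * t) (ht : 0 ≤ t) : |Real.exp (-a) - Real.exp (-b)| ≤ t := by
  wlog hab : a ≤ b generalizing a b
  · rw [abs_sub_comm]; exact this hb ha (by rwa [abs_sub_comm]) (le_of_not_ge hab)
  have h1 : Real.exp (-b) = Real.exp (-a) * Real.exp (a - b) := by
    rw [← Real.exp_add]; congr 1; ring
  rw [abs_of_nonneg (sub_nonneg.2 (Real.exp_le_exp.2 (neg_le_neg hab))), h1]
  have h2 := Real.add_one_le_exp (a - b)
  have h3 : b - a ≤ m * t := by rw [abs_sub_comm] at h; exact (le_abs_self _).trans h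
  have h4 : Real.exp (-a) ≤ Real.exp (-m) := Real.exp_le_exp.2 (neg_le_neg ha)
  have h5 : m * Real.exp (-m) ≤ 1 := by
    have := Real.add_one_le_exp m
    calc m * Real.exp (-m) ≤ Real.exp m * Real.exp (-m) := by gcongr; linarith
      _ = 1 := by rw [← Real.exp_add]; simp
  calc Real.exp (-a) - Real.exp (-a) * Real.exp (a - b)
      = Real.exp (-a) * (1 - Real.exp (a - b)) := by ring
    _ ≤ Real.exp (-m) * (m * t) := by
        refine mul_le_mul h4 (by linarith) ?_ (Real.exp_pos _).le
        rw [sub_nonneg, Real.exp_le_one_iff]; linarith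
    _ = m * Real.exp (-m) * t := by ring
    _ ≤ 1 * t := by gcongr
    _ = t := one_mul t

/-- Substitute `y = z ^ (-α)` in the Gamma integral at `1 - 1 / α`, which converges because `α > 1`.
-/
theorem lintegral_rpow_mul_exp_neg_rpow {α : ℝ} (hα : 1 < α) :
    ∫⁻ z in Set.Ioi (0 : ℝ), ENNReal.ofReal (z ^ (-α) * Real.exp (-z ^ (-α))) =
      ENNReal.ofReal (α⁻¹ * Real.Gamma (1 - 1 / α)) := by
  have hα0 : 0 < α := by linarith
  have hs : 0 < 1 - 1 / α := by rw [sub_pos, div_lt_one hα0]; exact hα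
  have key : ∀ z ∈ Set.Ioi (0 : ℝ),
      (|(-α)| * z ^ (-α - 1)) • (Real.exp (-z ^ (-α)) * (z ^ (-α)) ^ ((1 - 1 / α) - 1)) =
        α * (z ^ (-α) * Real.exp (-z ^ (-α))) := by
    intro z hz
    have hz : 0 < z := hz
    rw [abs_neg, abs_of_pos hα0, ← Real.rpow_mul hz.le, smul_eq_mul]
    have : z ^ (-α - 1) * z ^ (-α * (1 - 1 / α - 1)) = z ^ (-α) := by
      rw [← Real.rpow_add hz]; congr 1; field_simp; ring
    rw [← this]; ring
  have hint := Real.GammaIntegral_convergent hs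
  rw [← integrableOn_Ioi_comp_rpow_iff _ (neg_ne_zero.2 hα0.ne'),
    integrableOn_congr_fun key measurableSet_Ioi] at hint
  have hval := Real.Gamma_eq_integral hs
  rw [← integral_comp_rpow_Ioi _ (neg_ne_zero.2 hα0.ne'),
    setIntegral_congr_fun measurableSet_Ioi key, integral_const_mul] at hval
  rw [hval, inv_mul_cancel_left₀ hα0.ne', ofReal_integral_eq_lintegral_ofReal]
  · exact (integrable_const_mul_iff (isUnit_iff_ne_zero.2 hα0.ne') _).1 hint
  · filter_upwards [ae_restrict_mem measurableSet_Ioi] with z hz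
    have hz : 0 < z := hz
    positivity

/-! ### Exponent measures of half-spaces and orthant complements -/

variable {d : ℕ} {N : Seminorm ℝ (Fin d → ℝ)} {α : ℝ}

instance (α : ℝ) : SFinite (radialMeasure α) := by
  unfold radialMeasure; infer_instance

theorem radialMeasure_Ioi (hα : 0 < α) {c : ℝ} (hc : 0 < c) :
    radialMeasure α (Set.Ioi c) = ENNReal.ofReal (c ^ (-α)) := by
  rw [radialMeasure, withDensity_apply _ measurableSet_Ioi,
    Measure.restrict_restrict measurableSet_Ioi,
    Set.inter_eq_left.2 (Set.Ioi_subset_Ioi hc.le)]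
  rw [← ofReal_integral_eq_lintegral_ofReal
    ((integrableOn_Ioi_rpow_of_lt (by linarith) hc).const_mul α)]
  · rw [integral_const_mul, integral_Ioi_rpow_of_lt (by linarith) hc]
    congr 1
    rw [show -(α + 1) + 1 = -α by ring]
    field_simp
  · filter_upwards [ae_restrict_mem measurableSet_Ioi] with r hr
    have : 0 < r := hc.trans hr
    positivity

theorem measurable_polar (α : ℝ) : Measurable fun (p : ℝ × posSphere N) (j : Fin d) =>
    p.1 * ((p.2 : Fin d → ℝ) j) ^ (1 / α) := by
  refine measurable_pi_lambda _ fun j => measurable_fst.mul ?_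
  exact ((measurable_pi_apply j).comp (measurable_subtype_coe.comp measurable_snd)).pow_const _

theorem measurable_coord (j : Fin d) : Measurable fun u : posSphere N => (u : Fin d → ℝ) j :=
  (measurable_pi_apply j).comp measurable_subtype_coe

theorem exponentMeasure_apply (α : ℝ) (ν : Measure (posSphere N)) [SFinite ν]
    {S : Set (Fin d → ℝ)} (hS : MeasurableSet S) :
    exponentMeasure α ν S =
      ∫⁻ u, radialMeasure α {r | (fun j => r * ((u : Fin d → ℝ) j) ^ (1 / α)) ∈ S} ∂ν := by
  rw [exponentMeasure, Measure.map_apply (measurable_polar α) hS,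
    Measure.prod_apply_symm (measurable_polar α hS)]
  rfl

theorem exponentMeasure_add (α : ℝ) (ν ν' : Measure (posSphere N)) [SFinite ν] [SFinite ν'] :
    exponentMeasure α (ν + ν') = exponentMeasure α ν + exponentMeasure α ν' := by
  ext S hS
  rw [Measure.add_apply, exponentMeasure_apply _ _ hS, exponentMeasure_apply _ _ hS,
    exponentMeasure_apply _ _ hS, lintegral_add_measure]

/-- Along direction `u` the radius must exceed `z / uʲ ^ (1 / α)`, an event of radial mass `z ^ (-α)
* uʲ`: the power `1 / α` makes the mass linear in `u`, so that the moment constraints apply. -/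
theorem exponentMeasure_coord (hα : 0 < α) (ν : Measure (posSphere N)) [SFinite ν] (j : Fin d)
    {z : ℝ} (hz : 0 < z) : exponentMeasure α ν {x | z < x j} =
      ENNReal.ofReal (z ^ (-α)) * ∫⁻ u, ENNReal.ofReal ((u : Fin d → ℝ) j) ∂ν := by
  rw [exponentMeasure_apply _ _ (measurableSet_lt measurable_const (measurable_pi_apply j)),
    ← lintegral_const_mul _ (measurable_coord j).ennreal_ofReal]
  refine lintegral_congr fun u => ?_
  simp only [Set.mem_ofPred_eq]
  rcases (u.2.1 j).eq_or_lt with hu | hu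
  · rw [← hu, Real.zero_rpow (by positivity)]
    simp [hz.not_gt]
  · have : {r : ℝ | z < r * ((u : Fin d → ℝ) j) ^ (1 / α)} =
        Set.Ioi (z / ((u : Fin d → ℝ) j) ^ (1 / α)) := by
      ext r
      rw [Set.mem_Ioi, div_lt_iff₀ (by positivity)]; rfl
    rw [this, radialMeasure_Ioi hα (by positivity), ← ENNReal.ofReal_mul (by positivity),
      Real.div_rpow hz.le (by positivity), ← Real.rpow_mul hu.le]
    congr 1
    rw [show 1 / α * -α = -1 by field_simp, Real.rpow_neg_one, div_inv_eq_mul]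

theorem measurableSet_not_le (z : Fin d → ℝ) : MeasurableSet {x : Fin d → ℝ | ¬ ∀ j, x j ≤ z j} :=
  (measurableSet_Iic (a := z)).compl

/-- Since `uʲ ≤ 1`, leaving the orthant in any coordinate requires radius greater than `m`; hence no
sum over coordinates. -/
theorem exponentMeasure_not_le_le (hN : IsReferenceNorm N) (hα : 0 < α)
    (ν : Measure (posSphere N)) [SFinite ν] {z : Fin d → ℝ} {m : ℝ} (hm : 0 < m)
    (hz : ∀ j, m ≤ z j) : exponentMeasure α ν {x | ¬ ∀ j, x j ≤ z j} ≤
      ENNReal.ofReal (m ^ (-α)) * ν Set.univ := by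
  rw [exponentMeasure_apply _ _ (measurableSet_not_le z), ← lintegral_const]
  refine lintegral_mono fun u => ?_
  rw [← radialMeasure_Ioi hα hm]
  refine measure_mono fun r hr => ?_
  obtain ⟨j, hj⟩ := not_forall.1 hr
  have hu0 := u.2.1 j
  have hu1 := hN.le_one u u.2 j
  have h1 : ((u : Fin d → ℝ) j) ^ (1 / α) ≤ 1 := Real.rpow_le_one hu0 hu1 (by positivity)
  have h0 : 0 ≤ ((u : Fin d → ℝ) j) ^ (1 / α) := by positivity
  have h2 : m < r * ((u : Fin d → ℝ) j) ^ (1 / α) := (hz j).trans_lt (not_le.1 hj)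
  rw [Set.mem_Ioi]
  by_contra h
  nlinarith

theorem lintegral_coord_le (hN : IsReferenceNorm N) (ν : Measure (posSphere N)) (j : Fin d) :
    ∫⁻ u, ENNReal.ofReal ((u : Fin d → ℝ) j) ∂ν ≤ ν Set.univ := by
  calc _ ≤ ∫⁻ _, 1 ∂ν := lintegral_mono fun u => by
        rw [← ENNReal.ofReal_one]; exact ENNReal.ofReal_le_ofReal (hN.le_one u u.2 j)
    _ = _ := lintegral_one

theorem MomentConstraints.lintegral_eq_one {ν : Measure (posSphere N)} (h : MomentConstraints ν)
    (j : Fin d) : ∫⁻ u, ENNReal.ofReal ((u : Fin d → ℝ) j) ∂ν = 1 := by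
  -- A non-integrable function would have Bochner integral `0`, not `1`.
  have hi : Integrable (fun u : posSphere N => (u : Fin d → ℝ) j) ν := by
    by_contra hn
    have := h j
    rw [integral_undef hn] at this
    exact zero_ne_one this
  rw [← ofReal_integral_eq_lintegral_ofReal hi (.of_forall fun u => u.2.1 j), h j,
    ENNReal.ofReal_one]

/-! ### The Kolmogorov bound -/

theorem kolmogorovDist_le (hN : IsReferenceNorm N) (hα : 0 < α)
    (ν₁ ν₂ : Measure (posSphere N)) [IsFiniteMeasure ν₁] [IsFiniteMeasure ν₂]
    (hν₁ : MomentConstraints ν₁) (hν₂ : MomentConstraints ν₂)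
    {Ω₁ Ω₂ : Type*} [MeasurableSpace Ω₁] [MeasurableSpace Ω₂]
    {P₁ : Measure Ω₁} {P₂ : Measure Ω₂} {Z₁ : Ω₁ → Fin d → ℝ} {Z₂ : Ω₂ → Fin d → ℝ}
    (hZ₁ : IsMS P₁ α ν₁ Z₁) (hZ₂ : IsMS P₂ α ν₂ Z₂) :
    kolmogorovDist P₁ P₂ Z₁ Z₂ ≤ (d : ℝ≥0∞) * tvDist ν₁ ν₂ := by
  refine iSup₂_le fun z hz => ?_
  have hz : ∀ j, 0 < z j := hz
  rw [hZ₁.cdf_eq z hz, hZ₂.cdf_eq z hz]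
  rcases Nat.eq_zero_or_pos d with rfl | hd
  · simp
  obtain ⟨w, p, n, _, _, _, h1, h2, htv⟩ := exists_common_part ν₁ ν₂
  have : Nonempty (Fin d) := ⟨⟨0, hd⟩⟩
  -- The smallest coordinate governs both sides: exceeding it alone gives the lower bound on the
  -- exponents, and the radius gives the upper bound, both of order `z i ^ (-α)`.
  obtain ⟨i, hi⟩ := Finite.exists_min z
  have hlow : ∀ ν : Measure (posSphere N), IsFiniteMeasure ν → MomentConstraints ν →
      z i ^ (-α) ≤ (exponentMeasure α ν).real {x | ¬ ∀ j, x j ≤ z j} := by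
    intro ν _ hν
    rw [measureReal_def, ← ENNReal.ofReal_le_iff_le_toReal]
    · calc _ = exponentMeasure α ν {x | z i < x i} := by
            rw [exponentMeasure_coord hα ν i (hz i), hν.lintegral_eq_one, mul_one]
        _ ≤ _ := measure_mono fun x (hx : z i < x i) (h : ∀ j, x j ≤ z j) => (h i).not_gt hx
    · exact ne_top_of_le_ne_top (by finiteness)
        (exponentMeasure_not_le_le hN hα ν (hz i) hi)
  have hup : ∀ ν : Measure (posSphere N), IsFiniteMeasure ν →
      (exponentMeasure α ν).real {x | ¬ ∀ j, x j ≤ z j} ≤ z i ^ (-α) * ν.real Set.univ := by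
    intro ν _
    have := ENNReal.toReal_mono (by finiteness) (exponentMeasure_not_le_le hN hα ν (hz i) hi)
    rwa [ENNReal.toReal_mul, ENNReal.toReal_ofReal (Real.rpow_nonneg (hz i).le _)] at this
  have hfin : ∀ ν : Measure (posSphere N), IsFiniteMeasure ν →
      exponentMeasure α ν {x | ¬ ∀ j, x j ≤ z j} ≠ ∞ := fun ν _ =>
    ne_top_of_le_ne_top (by finiteness) (exponentMeasure_not_le_le hN hα ν (hz i) hi)
  have hreal : |Real.exp (-(exponentMeasure α ν₁).real {x | ¬ ∀ j, x j ≤ z j}) -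
      Real.exp (-(exponentMeasure α ν₂).real {x | ¬ ∀ j, x j ≤ z j})| ≤
      p.real Set.univ + n.real Set.univ := by
    refine abs_exp_neg_sub_exp_neg_le (hlow ν₁ inferInstance hν₁) (hlow ν₂ inferInstance hν₂) ?_
      (by positivity)
    have e1 := measureReal_add_apply (μ₁ := exponentMeasure α w) (μ₂ := exponentMeasure α p)
      (s := {x : Fin d → ℝ | ¬ ∀ j, x j ≤ z j}) (hfin w inferInstance) (hfin p inferInstance)
    have e2 := measureReal_add_apply (μ₁ := exponentMeasure α w) (μ₂ := exponentMeasure α n)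
      (s := {x : Fin d → ℝ | ¬ ∀ j, x j ≤ z j}) (hfin w inferInstance) (hfin n inferInstance)
    rw [h1, h2, exponentMeasure_add, exponentMeasure_add, e1, e2, add_sub_add_left_eq_sub]
    have hp := hup p inferInstance
    have hn := hup n inferInstance
    have hp0 : 0 ≤ (exponentMeasure α p).real {x | ¬ ∀ j, x j ≤ z j} := measureReal_nonneg
    have hn0 : 0 ≤ (exponentMeasure α n).real {x | ¬ ∀ j, x j ≤ z j} := measureReal_nonneg
    rw [abs_le, mul_add]
    constructor <;> linarith
  calc _ ≤ ENNReal.ofReal (p.real Set.univ + n.real Set.univ) := ENNReal.ofReal_le_ofReal hreal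
    _ = tvDist ν₁ ν₂ := by
        rw [ENNReal.ofReal_add (by positivity) (by positivity), ofReal_measureReal,
          ofReal_measureReal, htv]
    -- For `d ≥ 1` the estimate already holds without the factor `d`.
    _ ≤ _ := le_mul_of_one_le_left zero_le (by exact_mod_cast hd)

/-! ### Laws truncated from below -/

instance : MeasurableSup₂ (Fin d → ℝ) :=
  ⟨measurable_pi_lambda _ fun j => ((measurable_pi_apply j).comp measurable_fst).sup
    ((measurable_pi_apply j).comp measurable_snd)⟩

theorem ext_of_Iic_pi (μ ν : Measure (Fin d → ℝ)) [IsProbabilityMeasure μ] [IsProbabilityMeasure ν]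
    (h : ∀ z, μ (Set.Iic z) = ν (Set.Iic z)) : μ = ν := by
  have hspan : IsCountablySpanning (Set.range (Set.Iic : ℝ → Set ℝ)) := by
    refine ⟨fun n => Set.Iic (n : ℝ), fun n => ⟨n, rfl⟩, ?_⟩
    ext x
    simpa using exists_nat_ge x
  refine ext_of_generate_finite _ ?_
    (IsPiSystem.pi (C := fun _ : Fin d => Set.range (Set.Iic : ℝ → Set ℝ))
      fun _ => isPiSystem_Iic) ?_ (by simp)
  · rw [← generateFrom_pi_eq fun _ => hspan]
    congr 1
    funext i
    exact (BorelSpace.measurable_eq (α := ℝ)).trans (borel_eq_generateFrom_Iic ℝ)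
  · rintro _ ⟨s, hs, rfl⟩
    choose z hz using fun i => hs i trivial
    have : Set.univ.pi s = Set.Iic z := by
      rw [← Set.pi_univ_Iic]
      congr 1
      funext i
      exact (hz i).symm
    rw [this, h z]

/-- Starting the Poisson maximum at `(ε, …, ε)` leaves only finite intensity. No moment constraint
is needed, so this covers the pieces `w`, `p`, `n`. -/
theorem exists_truncated_maxLaw (hN : IsReferenceNorm N) (hα : 0 < α)
    (ν : Measure (posSphere N)) [IsFiniteMeasure ν] {ε : ℝ} (hε : 0 < ε) :
    ∃ Q : Measure (Fin d → ℝ), IsProbabilityMeasure Q ∧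
      (∀ z : Fin d → ℝ, (∀ j, ε ≤ z j) → Q (Set.Iic z) =
        ENNReal.ofReal (Real.exp (-(exponentMeasure α ν).real {x | ¬ ∀ j, x j ≤ z j}))) ∧
      ∀ j z, ε ≤ z → Q {x | x j ≤ z} = ENNReal.ofReal
        (Real.exp (-(z ^ (-α) * (∫⁻ u, ENNReal.ofReal ((u : Fin d → ℝ) j) ∂ν).toReal))) := by
  obtain ⟨Q, hQ, hQS⟩ := exists_maxLaw (exponentMeasure α ν) (fun _ : Fin d => ε)
    (ne_top_of_le_ne_top (by finiteness)
      (exponentMeasure_not_le_le hN hα ν (z := fun _ => ε) hε fun _ => le_rfl))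
  refine ⟨Q, hQ, fun z hz => ?_, fun j z hz => ?_⟩
  · exact hQS (Set.Iic z) measurableSet_Iic hz fun x y => sup_le_iff (a := x) (b := y) (c := z)
  · rw [hQS {x | x j ≤ z} (measurableSet_le (measurable_pi_apply j) measurable_const) hz
      fun x y => sup_le_iff (a := x j) (b := y j) (c := z)]
    have : {x : Fin d → ℝ | x j ≤ z}ᶜ = {x | z < x j} := by
      ext x; exact not_le (a := x j) (b := z)
    rw [this, measureReal_def, exponentMeasure_coord hα ν j (hε.trans_le hz), ENNReal.toReal_mul,
      ENNReal.toReal_ofReal (Real.rpow_nonneg (hε.le.trans hz) _)]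

/-- After raising to `ε`, the distribution function vanishes unless `z ≥ ε`, and there it is the
prescribed one; lower orthants determine the law. -/
theorem IsMS.map_sup_eq {Ω : Type*} [MeasurableSpace Ω] {P : Measure Ω} [IsProbabilityMeasure P]
    {ν : Measure (posSphere N)} {Z : Ω → Fin d → ℝ} (hZ : IsMS P α ν Z) {ε : ℝ} (hε : 0 < ε)
    (R : Measure (Fin d → ℝ)) [IsProbabilityMeasure R]
    (hR : ∀ z : Fin d → ℝ, (∀ j, ε ≤ z j) → R (Set.Iic z) =
        ENNReal.ofReal (Real.exp (-(exponentMeasure α ν).real {x | ¬ ∀ j, x j ≤ z j}))) :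
    P.map (fun ω => Z ω ⊔ fun _ => ε) = R.map (fun x => x ⊔ fun _ => ε) := by
  have hm : Measurable fun x : Fin d → ℝ => x ⊔ fun _ => ε := measurable_id.sup_const _
  have hZm : AEMeasurable (fun ω => Z ω ⊔ fun _ => ε) P := hm.comp_aemeasurable hZ.aemeasurable
  have := Measure.isProbabilityMeasure_map hZm
  have := Measure.isProbabilityMeasure_map (μ := R) hm.aemeasurable
  refine ext_of_Iic_pi _ _ fun z => ?_
  rw [Measure.map_apply_of_aemeasurable hZm measurableSet_Iic,
    Measure.map_apply hm measurableSet_Iic]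
  by_cases hz : ∀ j, ε ≤ z j
  · have h1 : (fun ω => Z ω ⊔ fun _ => ε) ⁻¹' Set.Iic z = {ω | ∀ j, Z ω j ≤ z j} := by
      ext ω
      exact sup_le_iff.trans (and_iff_left (show (fun _ => ε) ≤ z from hz))
    have h2 : (fun x : Fin d → ℝ => x ⊔ fun _ => ε) ⁻¹' Set.Iic z = Set.Iic z := by
      ext x
      exact sup_le_iff.trans (and_iff_left (show (fun _ => ε) ≤ z from hz))
    rw [h1, h2, hR z hz, ← hZ.cdf_eq z fun j => hε.trans_le (hz j), cdf, ofReal_measureReal]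
  · have h1 : (fun ω => Z ω ⊔ fun _ => ε) ⁻¹' Set.Iic z = ∅ := by
      ext ω
      exact iff_of_false (fun h : (Z ω ⊔ fun _ => ε) ≤ z => hz (le_sup_right.trans h)) id
    have h2 : (fun x : Fin d → ℝ => x ⊔ fun _ => ε) ⁻¹' Set.Iic z = ∅ := by
      ext x
      exact iff_of_false (fun h : (x ⊔ fun _ => ε) ≤ z => hz (le_sup_right.trans h)) id
    rw [h1, h2, measure_empty, measure_empty]

/-! ### Fréchet marginals, positivity and integrability -/

section marginals

variable {Ω : Type*} [MeasurableSpace Ω] {P : Measure Ω} {Z : Ω → Fin d → ℝ}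

theorem IsMS.aemeasurable_coord {ν : Measure (posSphere N)} (hZ : IsMS P α ν Z) (j : Fin d) :
    AEMeasurable (fun ω => Z ω j) P :=
  (measurable_pi_apply j).comp_aemeasurable hZ.aemeasurable

variable [IsProbabilityMeasure P] {ν : Measure (posSphere N)} [IsFiniteMeasure ν]

/-- A marginal would require the other coordinates of the level to tend to infinity. Truncating at
`z` itself avoids the limit: it does not change the event, and the truncated law has known
half-space masses. -/
theorem IsMS.measure_coord_le (hN : IsReferenceNorm N) (hα : 0 < α) (hν : MomentConstraints ν)
    (hZ : IsMS P α ν Z) (j : Fin d) {z : ℝ} (hz : 0 < z) :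
    P {ω | Z ω j ≤ z} = ENNReal.ofReal (Real.exp (-z ^ (-α))) := by
  obtain ⟨Q, _, hQ1, hQ2⟩ := exists_truncated_maxLaw hN hα ν hz
  have hm : Measurable fun x : Fin d → ℝ => x ⊔ fun _ => z := measurable_id.sup_const _
  have hS : MeasurableSet {x : Fin d → ℝ | x j ≤ z} :=
    measurableSet_le (measurable_pi_apply j) measurable_const
  have hZm : AEMeasurable (fun ω => Z ω ⊔ fun _ => z) P := hm.comp_aemeasurable hZ.aemeasurable
  have h := congrArg (fun m : Measure (Fin d → ℝ) => m {x | x j ≤ z}) (hZ.map_sup_eq hz Q hQ1)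
  simp only [Measure.map_apply_of_aemeasurable hZm hS, Measure.map_apply hm hS] at h
  have e1 : (fun ω => Z ω ⊔ fun _ => z) ⁻¹' {x | x j ≤ z} = {ω | Z ω j ≤ z} := by
    ext ω
    exact (sup_le_iff (a := Z ω j) (b := z) (c := z)).trans (and_iff_left le_rfl)
  have e2 : (fun x : Fin d → ℝ => x ⊔ fun _ => z) ⁻¹' {x | x j ≤ z} = {x | x j ≤ z} := by
    ext x
    exact (sup_le_iff (a := x j) (b := z) (c := z)).trans (and_iff_left le_rfl)
  rw [← e1, h, e2, hQ2 j z le_rfl, hν.lintegral_eq_one, ENNReal.toReal_one, mul_one]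

/-- The marginal satisfies `exp (-z ^ (-α)) ≤ z ^ α`, which tends to `0` with `z`. -/
theorem IsMS.ae_pos (hN : IsReferenceNorm N) (hα : 0 < α) (hν : MomentConstraints ν)
    (hZ : IsMS P α ν Z) (j : Fin d) : ∀ᵐ ω ∂P, 0 < Z ω j := by
  rw [ae_iff]
  simp only [not_lt]
  refine le_antisymm (ge_of_tendsto (x := nhdsWithin (0 : ℝ) (Set.Ioi 0))
    (f := fun z => ENNReal.ofReal (z ^ α)) ?_ ?_) zero_le
  · have : Filter.Tendsto (fun z : ℝ => ENNReal.ofReal (z ^ α)) (nhds 0)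
        (nhds (ENNReal.ofReal ((0 : ℝ) ^ α))) :=
      ENNReal.tendsto_ofReal (Real.continuousAt_rpow_const _ _ (.inr hα.le)).tendsto
    rw [Real.zero_rpow hα.ne', ENNReal.ofReal_zero] at this
    exact this.mono_left nhdsWithin_le_nhds
  · filter_upwards [self_mem_nhdsWithin] with z hz
    have hz : 0 < z := hz
    calc P {ω | Z ω j ≤ 0} ≤ P {ω | Z ω j ≤ z} :=
          measure_mono fun ω (h : Z ω j ≤ 0) => h.trans hz.le
      _ = _ := hZ.measure_coord_le hN hα hν j hz
      _ ≤ _ := by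
          refine ENNReal.ofReal_le_ofReal ?_
          have h1 : 0 < z ^ (-α) := Real.rpow_pos_of_pos hz _
          have h2 := Real.add_one_le_exp (z ^ (-α))
          have h3 : z ^ α = (z ^ (-α))⁻¹ := by rw [Real.rpow_neg hz.le, inv_inv]
          rw [Real.exp_neg, h3]
          exact inv_anti₀ h1 (by linarith)

theorem IsMS.integrable_coord (hN : IsReferenceNorm N) (hα : 1 < α) (hν : MomentConstraints ν)
    (hZ : IsMS P α ν Z) (j : Fin d) : Integrable (fun ω => Z ω j) P := by
  have hα0 : 0 < α := by linarith
  have hnn : 0 ≤ᵐ[P] fun ω => Z ω j := (hZ.ae_pos hN hα0 hν j).mono fun ω h => h.le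
  refine ⟨(hZ.aemeasurable_coord j).aestronglyMeasurable, ?_⟩
  rw [hasFiniteIntegral_iff_ofReal hnn,
    lintegral_eq_lintegral_meas_lt P hnn (hZ.aemeasurable_coord j)]
  -- This tail is integrable at infinity exactly because `α > 1`.
  have htail : ∀ t : ℝ, 0 < t → P {ω | t < Z ω j} ≤ ENNReal.ofReal (t ^ (-α)) := by
    intro t ht
    have h0 : NullMeasurableSet {ω | Z ω j ≤ t} P :=
      nullMeasurableSet_le (hZ.aemeasurable_coord j) aemeasurable_const
    have h1 : {ω | t < Z ω j} = {ω | Z ω j ≤ t}ᶜ := by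
      ext ω; exact (not_le (a := Z ω j) (b := t)).symm
    rw [h1, prob_compl_eq_one_sub₀ h0, hZ.measure_coord_le hN hα0 hν j ht, ← ENNReal.ofReal_one,
      ← ENNReal.ofReal_sub _ (Real.exp_pos _).le]
    refine ENNReal.ofReal_le_ofReal ?_
    have := Real.add_one_le_exp (-t ^ (-α))
    linarith
  rw [← Set.Ioc_union_Ioi_eq_Ioi (zero_le_one' ℝ)]
  refine (lintegral_union_le _ _ _).trans_lt (ENNReal.add_lt_top.2 ⟨?_, ?_⟩)
  · calc _ ≤ ∫⁻ _ in Set.Ioc (0 : ℝ) 1, 1 := lintegral_mono fun t => prob_le_one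
      _ < ∞ := by simp
  · calc _ ≤ ∫⁻ t in Set.Ioi (1 : ℝ), ENNReal.ofReal (t ^ (-α)) :=
          setLIntegral_mono' measurableSet_Ioi fun t ht => htail t (zero_lt_one.trans ht)
      _ < ∞ := (integrableOn_Ioi_rpow_of_lt (by linarith) zero_lt_one).lintegral_lt_top

end marginals

/-! ### The coupling -/

/-- Use `1 - exp (-x) ≤ x` on the second factor and integrate over levels; below `ε` the crossing
event is empty. -/
theorem lintegral_ofReal_sub_le {Ω : Type*} [MeasurableSpace Ω] (Q : Measure Ω) [SFinite Q]
    {A B : Ω → ℝ} (hA : Measurable A) (hB : Measurable B) (hα : 1 < α) {ε : ℝ} (hε : 0 < ε)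
    (hAε : ∀ ω, ε ≤ A ω) {c : ℝ≥0∞} (hc : c ≠ ∞)
    (h : ∀ z, ε ≤ z → Q {ω | A ω ≤ z ∧ z < B ω} ≤ ENNReal.ofReal (Real.exp (-z ^ (-α))) *
      (1 - ENNReal.ofReal (Real.exp (-(z ^ (-α) * c.toReal))))) :
    ∫⁻ ω, ENNReal.ofReal (B ω - A ω) ∂Q ≤
      ENNReal.ofReal (α⁻¹ * Real.Gamma (1 - 1 / α)) * c := by
  have hmeas : Measurable fun z : ℝ =>
      ENNReal.ofReal (z ^ (-α) * Real.exp (-z ^ (-α))) := by fun_prop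
  rw [lintegral_ofReal_sub_eq Q hA hB, ← lintegral_rpow_mul_exp_neg_rpow hα,
    ← lintegral_mul_const _ hmeas, ← lintegral_indicator measurableSet_Ioi]
  refine lintegral_mono fun z => ?_
  rcases lt_or_ge z ε with hz | hz
  · have : {ω | A ω ≤ z ∧ z < B ω} = ∅ := by
      ext ω
      exact iff_of_false (fun h : A ω ≤ z ∧ z < B ω => (hz.trans_le (hAε ω)).not_ge h.1) id
    simp [this]
  · have hz0 : 0 < z := hε.trans_le hz
    rw [Set.indicator_of_mem (Set.mem_Ioi.2 hz0)]
    refine (h z hz).trans ?_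
    have hpos : 0 < z ^ (-α) := Real.rpow_pos_of_pos hz0 _
    rw [← ENNReal.ofReal_one, ← ENNReal.ofReal_sub _ (Real.exp_pos _).le,
      mul_comm (z ^ (-α)) (Real.exp _), ENNReal.ofReal_mul (Real.exp_pos _).le, mul_assoc]
    gcongr
    calc _ ≤ ENNReal.ofReal (z ^ (-α) * c.toReal) := by
          refine ENNReal.ofReal_le_ofReal ?_
          have := Real.add_one_le_exp (-(z ^ (-α) * c.toReal))
          linarith
      _ = _ := by rw [ENNReal.ofReal_mul hpos.le, ENNReal.ofReal_toReal hc]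

theorem enorm_sub_eq_ofReal_add_ofReal (a b : ℝ) :
    ‖a - b‖ₑ = ENNReal.ofReal (a - b) + ENNReal.ofReal (b - a) := by
  rw [Real.enorm_eq_ofReal_abs]
  rcases le_total a b with hab | hab
  · rw [abs_of_nonpos (by linarith), ENNReal.ofReal_of_nonpos (sub_nonpos.2 hab), zero_add, neg_sub]
  · rw [abs_of_nonneg (by linarith), ENNReal.ofReal_of_nonpos (sub_nonpos.2 hab), add_zero]

/-- Both vectors share the maximum drawn from `w`, and differ only through independent maxima drawn
from `p` and `n`. -/
theorem exists_coupling (hN : IsReferenceNorm N) (hα : 1 < α)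
    (ν₁ ν₂ : Measure (posSphere N)) [IsFiniteMeasure ν₁] [IsFiniteMeasure ν₂]
    (hν₁ : MomentConstraints ν₁) (hν₂ : MomentConstraints ν₂)
    {Ω₁ Ω₂ : Type*} [MeasurableSpace Ω₁] [MeasurableSpace Ω₂]
    {P₁ : Measure Ω₁} {P₂ : Measure Ω₂} [IsProbabilityMeasure P₁] [IsProbabilityMeasure P₂]
    {Z₁ : Ω₁ → Fin d → ℝ} {Z₂ : Ω₂ → Fin d → ℝ}
    (hZ₁ : IsMS P₁ α ν₁ Z₁) (hZ₂ : IsMS P₂ α ν₂ Z₂) {ε : ℝ} (hε : 0 < ε) :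
    ∃ (Q : Measure ((Fin d → ℝ) × (Fin d → ℝ) × (Fin d → ℝ)))
      (X₁ X₂ : (Fin d → ℝ) × (Fin d → ℝ) × (Fin d → ℝ) → Fin d → ℝ),
      Measurable X₁ ∧ Measurable X₂ ∧
      P₁.map (fun ω => Z₁ ω ⊔ fun _ => ε) = Q.map X₁ ∧
      P₂.map (fun ω => Z₂ ω ⊔ fun _ => ε) = Q.map X₂ ∧
      ∀ j, ∫⁻ q, ‖X₁ q j - X₂ q j‖ₑ ∂Q ≤
        ENNReal.ofReal (α⁻¹ * Real.Gamma (1 - 1 / α)) * tvDist ν₁ ν₂ := by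
  have hα0 : 0 < α := by linarith
  obtain ⟨w, p, n, _, _, _, h1, h2, htv⟩ := exists_common_part ν₁ ν₂
  obtain ⟨Qw, _, hw, hw'⟩ := exists_truncated_maxLaw hN hα0 w hε
  obtain ⟨Qp, _, hp, hp'⟩ := exists_truncated_maxLaw hN hα0 p hε
  obtain ⟨Qn, _, hn, hn'⟩ := exists_truncated_maxLaw hN hα0 n hε
  have hsup : Measurable fun x : Fin d → ℝ => x ⊔ fun _ => ε := measurable_id.sup_const _
  have hY₁ : Measurable fun q : (Fin d → ℝ) × (Fin d → ℝ) × (Fin d → ℝ) => q.1 ⊔ q.2.1 := by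
    fun_prop
  have hY₂ : Measurable fun q : (Fin d → ℝ) × (Fin d → ℝ) × (Fin d → ℝ) => q.1 ⊔ q.2.2 := by
    fun_prop
  have hmul : ∀ ν : Measure (posSphere N), IsFiniteMeasure ν → ∀ z : Fin d → ℝ, (∀ j, ε ≤ z j) →
      ENNReal.ofReal (Real.exp (-(exponentMeasure α w).real {x | ¬ ∀ j, x j ≤ z j})) *
      ENNReal.ofReal (Real.exp (-(exponentMeasure α ν).real {x | ¬ ∀ j, x j ≤ z j})) =
      ENNReal.ofReal (Real.exp (-(exponentMeasure α (w + ν)).real {x | ¬ ∀ j, x j ≤ z j})) := by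
    intro ν _ z hz
    rw [← ENNReal.ofReal_mul (Real.exp_pos _).le, ← Real.exp_add, exponentMeasure_add,
      measureReal_add_apply
        (ne_top_of_le_ne_top (by finiteness) (exponentMeasure_not_le_le hN hα0 w hε hz))
        (ne_top_of_le_ne_top (by finiteness) (exponentMeasure_not_le_le hN hα0 ν hε hz)), neg_add]
  have hL₁ : ∀ z : Fin d → ℝ, (∀ j, ε ≤ z j) →
      ((Qw.prod (Qp.prod Qn)).map fun q => q.1 ⊔ q.2.1) (Set.Iic z) =
      ENNReal.ofReal (Real.exp (-(exponentMeasure α ν₁).real {x | ¬ ∀ j, x j ≤ z j})) := by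
    intro z hz
    rw [Measure.map_apply hY₁ measurableSet_Iic, h1, ← hmul p inferInstance z hz, ← hw z hz,
      ← hp z hz]
    have : (fun q : (Fin d → ℝ) × (Fin d → ℝ) × (Fin d → ℝ) => q.1 ⊔ q.2.1) ⁻¹' Set.Iic z =
        Set.Iic z ×ˢ (Set.Iic z ×ˢ Set.univ) := by
      ext q; simp
    rw [this, Measure.prod_prod, Measure.prod_prod, measure_univ, mul_one]
  have hL₂ : ∀ z : Fin d → ℝ, (∀ j, ε ≤ z j) →
      ((Qw.prod (Qp.prod Qn)).map fun q => q.1 ⊔ q.2.2) (Set.Iic z) =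
      ENNReal.ofReal (Real.exp (-(exponentMeasure α ν₂).real {x | ¬ ∀ j, x j ≤ z j})) := by
    intro z hz
    rw [Measure.map_apply hY₂ measurableSet_Iic, h2, ← hmul n inferInstance z hz, ← hw z hz,
      ← hn z hz]
    have : (fun q : (Fin d → ℝ) × (Fin d → ℝ) × (Fin d → ℝ) => q.1 ⊔ q.2.2) ⁻¹' Set.Iic z =
        Set.Iic z ×ˢ (Set.univ ×ˢ Set.Iic z) := by
      ext q; simp
    rw [this, Measure.prod_prod, Measure.prod_prod, measure_univ, one_mul]
  refine ⟨Qw.prod (Qp.prod Qn), fun q => (q.1 ⊔ q.2.1) ⊔ fun _ => ε,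
    fun q => (q.1 ⊔ q.2.2) ⊔ fun _ => ε, hsup.comp hY₁, hsup.comp hY₂, ?_, ?_, fun j => ?_⟩
  · have := Measure.isProbabilityMeasure_map (μ := Qw.prod (Qp.prod Qn)) hY₁.aemeasurable
    rw [hZ₁.map_sup_eq hε _ hL₁, Measure.map_map hsup hY₁]
    rfl
  · have := Measure.isProbabilityMeasure_map (μ := Qw.prod (Qp.prod Qn)) hY₂.aemeasurable
    rw [hZ₂.map_sup_eq hε _ hL₂, Measure.map_map hsup hY₂]
    rfl
  have hA : Measurable fun q : (Fin d → ℝ) × (Fin d → ℝ) × (Fin d → ℝ) =>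
      ((q.1 ⊔ q.2.1) ⊔ fun _ => ε) j := (measurable_pi_apply j).comp (hsup.comp hY₁)
  have hB : Measurable fun q : (Fin d → ℝ) × (Fin d → ℝ) × (Fin d → ℝ) =>
      ((q.1 ⊔ q.2.2) ⊔ fun _ => ε) j := (measurable_pi_apply j).comp (hsup.comp hY₂)
  have hfin : ∀ ν : Measure (posSphere N), IsFiniteMeasure ν →
      ∫⁻ u, ENNReal.ofReal ((u : Fin d → ℝ) j) ∂ν ≠ ∞ := fun ν _ =>
    ne_top_of_le_ne_top (measure_ne_top _ _) (lintegral_coord_le hN ν j)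
  -- The `j`th moments of the two pieces add up to `1`, so the maximum of their points has the
  -- standard Fréchet marginal above `ε`.
  have hone : ∀ ν : Measure (posSphere N), IsFiniteMeasure ν → MomentConstraints (w + ν) → ∀ z,
      ENNReal.ofReal (Real.exp
        (-(z ^ (-α) * (∫⁻ u, ENNReal.ofReal ((u : Fin d → ℝ) j) ∂w).toReal))) *
      ENNReal.ofReal (Real.exp
        (-(z ^ (-α) * (∫⁻ u, ENNReal.ofReal ((u : Fin d → ℝ) j) ∂ν).toReal))) =
      ENNReal.ofReal (Real.exp (-z ^ (-α))) := by
    intro ν _ hν z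
    have h := hν.lintegral_eq_one j
    rw [lintegral_add_measure] at h
    have h' := congrArg ENNReal.toReal h
    rw [ENNReal.toReal_add (hfin w inferInstance) (hfin ν inferInstance), ENNReal.toReal_one] at h'
    rw [← ENNReal.ofReal_mul (Real.exp_pos _).le, ← Real.exp_add, ← neg_add, ← mul_add, h', mul_one]
  have hS : ∀ z, MeasurableSet {x : Fin d → ℝ | x j ≤ z} := fun z =>
    measurableSet_le (measurable_pi_apply j) measurable_const
  have hAB := lintegral_ofReal_sub_le (Qw.prod (Qp.prod Qn)) hA hB hα hε (fun q => le_sup_right)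
    (hfin n inferInstance) fun z hz => by
      -- Only the `n` component can carry the second vector above `z`: the common component is
      -- below, and `ε ≤ z`.
      calc _ ≤ (Qw.prod (Qp.prod Qn)) ({x | x j ≤ z} ×ˢ ({x | x j ≤ z} ×ˢ {x | x j ≤ z}ᶜ)) := by
            refine measure_mono fun q
              (hq : (q.1 j ⊔ q.2.1 j) ⊔ ε ≤ z ∧ z < (q.1 j ⊔ q.2.2 j) ⊔ ε) => ?_
            simp only [sup_le_iff, lt_sup_iff] at hq
            obtain ⟨⟨⟨ha, hb⟩, _⟩, (hc | hc) | hc⟩ := hq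
            · exact absurd ha hc.not_ge
            · exact ⟨ha, hb, fun h : q.2.2 j ≤ z => hc.not_ge h⟩
            · exact absurd hz hc.not_ge
        _ = _ := by
            rw [Measure.prod_prod, Measure.prod_prod, prob_compl_eq_one_sub (hS z), ← mul_assoc,
              hw' j z hz, hp' j z hz, hn' j z hz, hone p inferInstance (h1 ▸ hν₁) z]
  have hBA := lintegral_ofReal_sub_le (Qw.prod (Qp.prod Qn)) hB hA hα hε (fun q => le_sup_right)
    (hfin p inferInstance) fun z hz => by
      calc _ ≤ (Qw.prod (Qp.prod Qn)) ({x | x j ≤ z} ×ˢ ({x | x j ≤ z}ᶜ ×ˢ {x | x j ≤ z})) := by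
            refine measure_mono fun q
              (hq : (q.1 j ⊔ q.2.2 j) ⊔ ε ≤ z ∧ z < (q.1 j ⊔ q.2.1 j) ⊔ ε) => ?_
            simp only [sup_le_iff, lt_sup_iff] at hq
            obtain ⟨⟨⟨ha, hb⟩, _⟩, (hc | hc) | hc⟩ := hq
            · exact absurd ha hc.not_ge
            · exact ⟨ha, fun h : q.2.1 j ≤ z => hc.not_ge h, hb⟩
            · exact absurd hz hc.not_ge
        _ = _ := by
            rw [Measure.prod_prod, Measure.prod_prod, prob_compl_eq_one_sub (hS z),
              mul_comm (1 - _), ← mul_assoc,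
              hw' j z hz, hp' j z hz, hn' j z hz, hone n inferInstance (h2 ▸ hν₂) z]
  calc _ = ∫⁻ q : (Fin d → ℝ) × (Fin d → ℝ) × (Fin d → ℝ),
        (ENNReal.ofReal (((q.1 ⊔ q.2.1) ⊔ fun _ => ε) j - ((q.1 ⊔ q.2.2) ⊔ fun _ => ε) j) +
        ENNReal.ofReal (((q.1 ⊔ q.2.2) ⊔ fun _ => ε) j - ((q.1 ⊔ q.2.1) ⊔ fun _ => ε) j))
          ∂(Qw.prod (Qp.prod Qn)) :=
        lintegral_congr fun q => enorm_sub_eq_ofReal_add_ofReal _ _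
    _ ≤ _ := by
        rw [lintegral_add_left (by exact (hA.sub hB).ennreal_ofReal), htv, mul_add]
        exact add_le_add (hBA.trans (mul_le_mul_right (lintegral_coord_le hN p j) _))
          (hAB.trans (mul_le_mul_right (lintegral_coord_le hN n j) _))

/-! ### The Wasserstein bound -/

/-- Precomposition with the positive part makes a function of `lipOne d` globally Lipschitz. -/
theorem abs_comp_sup_zero_sub_le {h : (Fin d → ℝ) → ℝ} (hh : h ∈ lipOne d) (x y : Fin d → ℝ) :
    |h (x ⊔ 0) - h (y ⊔ 0)| ≤ ∑ j, |x j - y j| :=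
  (hh _ _ (fun j => le_sup_right (a := x j)) (fun j => le_sup_right (a := y j))).trans
    (Finset.sum_le_sum fun j _ => abs_max_sub_max_le_abs (x j) (y j) 0)

theorem continuous_comp_sup_zero {h : (Fin d → ℝ) → ℝ} (hh : h ∈ lipOne d) :
    Continuous fun x => h (x ⊔ 0) := by
  refine (LipschitzWith.of_dist_le_mul (K := (d : NNReal)) fun x y => ?_).continuous
  rw [Real.dist_eq]
  refine (abs_comp_sup_zero_sub_le hh x y).trans ?_
  calc ∑ j, |x j - y j| ≤ ∑ _j : Fin d, dist x y :=
        Finset.sum_le_sum fun j _ => by rw [← Real.dist_eq]; exact dist_le_pi_dist x y j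
    _ = _ := by simp

theorem IsMS.ae_comp_sup_zero_eq {Ω : Type*} [MeasurableSpace Ω] {P : Measure Ω}
    [IsProbabilityMeasure P] {ν : Measure (posSphere N)} [IsFiniteMeasure ν] {Z : Ω → Fin d → ℝ}
    (hN : IsReferenceNorm N) (hα : 0 < α) (hν : MomentConstraints ν) (hZ : IsMS P α ν Z)
    (h : (Fin d → ℝ) → ℝ) : (fun ω => h (Z ω ⊔ 0)) =ᵐ[P] fun ω => h (Z ω) := by
  filter_upwards [ae_all_iff.2 (hZ.ae_pos hN hα hν)] with ω hω
  rw [sup_eq_left.2 (show (0 : Fin d → ℝ) ≤ Z ω from fun j => (hω j).le)]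

theorem IsMS.integrable_comp_sup_zero {Ω : Type*} [MeasurableSpace Ω] {P : Measure Ω}
    [IsProbabilityMeasure P] {ν : Measure (posSphere N)} [IsFiniteMeasure ν] {Z : Ω → Fin d → ℝ}
    (hN : IsReferenceNorm N) (hα : 1 < α) (hν : MomentConstraints ν) (hZ : IsMS P α ν Z)
    {h : (Fin d → ℝ) → ℝ} (hh : h ∈ lipOne d) : Integrable (fun ω => h (Z ω ⊔ 0)) P := by
  have hb : Integrable (fun ω => |h (0 ⊔ 0)| + ∑ j, |Z ω j|) P :=
    (integrable_const _).add (integrable_finsetSum _ fun j _ =>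
      (hZ.integrable_coord hN hα hν j).abs)
  refine hb.mono' ((continuous_comp_sup_zero hh).measurable.comp_aemeasurable
    hZ.aemeasurable).aestronglyMeasurable (.of_forall fun ω => ?_)
  have h1 := abs_comp_sup_zero_sub_le hh (Z ω) 0
  simp only [Pi.zero_apply, sub_zero] at h1
  rw [Real.norm_eq_abs]
  have h2 := abs_sub_abs_le_abs_sub (h (Z ω ⊔ 0)) (h (0 ⊔ 0))
  linarith

/-- Raising a vector to at least `ε` in each coordinate moves a Lipschitz function by `d ε`. -/
theorem IsMS.enorm_integral_sub_integral_sup_le {Ω : Type*} [MeasurableSpace Ω] {P : Measure Ω}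
    [IsProbabilityMeasure P] {ν : Measure (posSphere N)} [IsFiniteMeasure ν] {Z : Ω → Fin d → ℝ}
    (hN : IsReferenceNorm N) (hα : 1 < α) (hν : MomentConstraints ν) (hZ : IsMS P α ν Z)
    {h : (Fin d → ℝ) → ℝ} (hh : h ∈ lipOne d) {ε : ℝ} (hε : 0 < ε) :
    Integrable (fun ω => h ((Z ω ⊔ fun _ => ε) ⊔ 0)) P ∧
    ‖(∫ ω, h (Z ω ⊔ 0) ∂P) - ∫ ω, h ((Z ω ⊔ fun _ => ε) ⊔ 0) ∂P‖ₑ ≤ ENNReal.ofReal (d * ε) := by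
  have hα0 : 0 < α := by linarith
  have hsup : Measurable fun x : Fin d → ℝ => x ⊔ fun _ => ε := measurable_id.sup_const _
  have hm : AEStronglyMeasurable (fun ω => h ((Z ω ⊔ fun _ => ε) ⊔ 0)) P :=
    ((continuous_comp_sup_zero hh).measurable.comp
      hsup |>.comp_aemeasurable hZ.aemeasurable).aestronglyMeasurable
  have hint := hZ.integrable_comp_sup_zero hN hα hν hh
  have hbound : ∀ᵐ ω ∂P, ‖h (Z ω ⊔ 0) - h ((Z ω ⊔ fun _ => ε) ⊔ 0)‖ ≤ d * ε := by
    filter_upwards [ae_all_iff.2 (hZ.ae_pos hN hα0 hν)] with ω hω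
    rw [Real.norm_eq_abs]
    refine (abs_comp_sup_zero_sub_le hh _ _).trans ?_
    calc _ ≤ ∑ _j : Fin d, ε := Finset.sum_le_sum fun j _ => by
          have hj := hω j
          change |Z ω j - max (Z ω j) ε| ≤ ε
          rcases le_total (Z ω j) ε with h1 | h1
          · rw [max_eq_right h1, abs_le]; constructor <;> linarith
          · rw [max_eq_left h1, sub_self, abs_zero]; exact hε.le
      _ = _ := by simp
  -- The difference is bounded, so integrability passes from `Z` to its truncation.
  have hdiff : Integrable (fun ω => h (Z ω ⊔ 0) - h ((Z ω ⊔ fun _ => ε) ⊔ 0)) P :=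
    (integrable_const (d * ε)).mono' (hint.aestronglyMeasurable.sub hm) hbound
  have hint' : Integrable (fun ω => h ((Z ω ⊔ fun _ => ε) ⊔ 0)) P := by
    have := hint.sub hdiff
    refine this.congr (.of_forall fun ω => ?_)
    simp
  refine ⟨hint', ?_⟩
  rw [← integral_sub hint hint', ← ofReal_norm]
  refine ENNReal.ofReal_le_ofReal ?_
  simpa using norm_integral_le_of_norm_le_const hbound

/-- Triangle inequality through the coupling; each truncation costs `d * ε`. -/
theorem enorm_integral_sub_integral_le (hN : IsReferenceNorm N) (hα : 1 < α)
    (ν₁ ν₂ : Measure (posSphere N)) [IsFiniteMeasure ν₁] [IsFiniteMeasure ν₂]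
    (hν₁ : MomentConstraints ν₁) (hν₂ : MomentConstraints ν₂)
    {Ω₁ Ω₂ : Type*} [MeasurableSpace Ω₁] [MeasurableSpace Ω₂]
    {P₁ : Measure Ω₁} {P₂ : Measure Ω₂} [IsProbabilityMeasure P₁] [IsProbabilityMeasure P₂]
    {Z₁ : Ω₁ → Fin d → ℝ} {Z₂ : Ω₂ → Fin d → ℝ}
    (hZ₁ : IsMS P₁ α ν₁ Z₁) (hZ₂ : IsMS P₂ α ν₂ Z₂)
    {h : (Fin d → ℝ) → ℝ} (hh : h ∈ lipOne d) {ε : ℝ} (hε : 0 < ε) :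
    ‖(∫ ω, h (Z₁ ω ⊔ 0) ∂P₁) - ∫ ω, h (Z₂ ω ⊔ 0) ∂P₂‖ₑ ≤
      d * (ENNReal.ofReal (α⁻¹ * Real.Gamma (1 - 1 / α)) * tvDist ν₁ ν₂) +
        ENNReal.ofReal (2 * d * ε) := by
  obtain ⟨Q, X₁, X₂, hX₁, hX₂, e1, e2, hX⟩ := exists_coupling hN hα ν₁ ν₂ hν₁ hν₂ hZ₁ hZ₂ hε
  obtain ⟨i1, b1⟩ := hZ₁.enorm_integral_sub_integral_sup_le hN hα hν₁ hh hε
  obtain ⟨i2, b2⟩ := hZ₂.enorm_integral_sub_integral_sup_le hN hα hν₂ hh hε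
  have hsup : Measurable fun x : Fin d → ℝ => x ⊔ fun _ => ε := measurable_id.sup_const _
  have hg : StronglyMeasurable fun x : Fin d → ℝ => h (x ⊔ 0) :=
    (continuous_comp_sup_zero hh).measurable.stronglyMeasurable
  have m1 : AEMeasurable (fun ω => Z₁ ω ⊔ fun _ => ε) P₁ := hsup.comp_aemeasurable hZ₁.aemeasurable
  have m2 : AEMeasurable (fun ω => Z₂ ω ⊔ fun _ => ε) P₂ := hsup.comp_aemeasurable hZ₂.aemeasurable
  have j1 : Integrable (fun q => h (X₁ q ⊔ 0)) Q := by
    refine (integrable_map_measure hg.aestronglyMeasurable hX₁.aemeasurable).1 ?_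
    rw [← e1]
    exact (integrable_map_measure hg.aestronglyMeasurable m1).2 i1
  have j2 : Integrable (fun q => h (X₂ q ⊔ 0)) Q := by
    refine (integrable_map_measure hg.aestronglyMeasurable hX₂.aemeasurable).1 ?_
    rw [← e2]
    exact (integrable_map_measure hg.aestronglyMeasurable m2).2 i2
  have k1 : ∫ ω, h ((Z₁ ω ⊔ fun _ => ε) ⊔ 0) ∂P₁ = ∫ q, h (X₁ q ⊔ 0) ∂Q := by
    rw [← integral_map (f := fun x => h (x ⊔ 0)) m1 hg.aestronglyMeasurable, e1,
      integral_map hX₁.aemeasurable hg.aestronglyMeasurable]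
  have k2 : ∫ ω, h ((Z₂ ω ⊔ fun _ => ε) ⊔ 0) ∂P₂ = ∫ q, h (X₂ q ⊔ 0) ∂Q := by
    rw [← integral_map (f := fun x => h (x ⊔ 0)) m2 hg.aestronglyMeasurable, e2,
      integral_map hX₂.aemeasurable hg.aestronglyMeasurable]
  have hmid : ‖(∫ q, h (X₁ q ⊔ 0) ∂Q) - ∫ q, h (X₂ q ⊔ 0) ∂Q‖ₑ ≤
      d * (ENNReal.ofReal (α⁻¹ * Real.Gamma (1 - 1 / α)) * tvDist ν₁ ν₂) := by
    rw [← integral_sub j1 j2]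
    calc _ ≤ ∫⁻ q, ‖h (X₁ q ⊔ 0) - h (X₂ q ⊔ 0)‖ₑ ∂Q := enorm_integral_le_lintegral_enorm _
      _ ≤ ∫⁻ q, ∑ j, ‖X₁ q j - X₂ q j‖ₑ ∂Q := by
          refine lintegral_mono fun q => ?_
          simp only [Real.enorm_eq_ofReal_abs]
          rw [← ENNReal.ofReal_sum_of_nonneg fun j _ => abs_nonneg _]
          exact ENNReal.ofReal_le_ofReal (abs_comp_sup_zero_sub_le hh _ _)
      _ = ∑ j, ∫⁻ q, ‖X₁ q j - X₂ q j‖ₑ ∂Q := lintegral_finsetSum _ fun j _ =>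
          (((measurable_pi_apply j).comp hX₁).sub ((measurable_pi_apply j).comp hX₂)).enorm
      _ ≤ ∑ _j : Fin d, _ := Finset.sum_le_sum fun j _ => hX j
      _ = _ := by simp
  rw [k1] at b1
  rw [k2, ← enorm_neg, neg_sub] at b2
  have hε2 : ENNReal.ofReal (2 * d * ε) = ENNReal.ofReal (d * ε) + ENNReal.ofReal (d * ε) := by
    rw [← ENNReal.ofReal_add (by positivity) (by positivity)]; congr 1; ring
  rw [hε2, add_left_comm]
  calc _ = ‖((∫ ω, h (Z₁ ω ⊔ 0) ∂P₁) - ∫ q, h (X₁ q ⊔ 0) ∂Q) +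
        (((∫ q, h (X₁ q ⊔ 0) ∂Q) - ∫ q, h (X₂ q ⊔ 0) ∂Q) +
          ((∫ q, h (X₂ q ⊔ 0) ∂Q) - ∫ ω, h (Z₂ ω ⊔ 0) ∂P₂))‖ₑ := by congr 1; ring
    _ ≤ _ := (enorm_add_le _ _).trans (add_le_add b1 ((enorm_add_le _ _).trans
        (add_le_add hmid b2)))

theorem wassersteinDist_le (hN : IsReferenceNorm N) (hα : 1 < α)
    (ν₁ ν₂ : Measure (posSphere N)) [IsFiniteMeasure ν₁] [IsFiniteMeasure ν₂]
    (hν₁ : MomentConstraints ν₁) (hν₂ : MomentConstraints ν₂)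
    {Ω₁ Ω₂ : Type*} [MeasurableSpace Ω₁] [MeasurableSpace Ω₂]
    {P₁ : Measure Ω₁} {P₂ : Measure Ω₂} [IsProbabilityMeasure P₁] [IsProbabilityMeasure P₂]
    {Z₁ : Ω₁ → Fin d → ℝ} {Z₂ : Ω₂ → Fin d → ℝ}
    (hZ₁ : IsMS P₁ α ν₁ Z₁) (hZ₂ : IsMS P₂ α ν₂ Z₂) :
    wassersteinDist P₁ P₂ Z₁ Z₂ ≤
      ENNReal.ofReal (d * Real.Gamma (1 - 1 / α)) * tvDist ν₁ ν₂ := by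
  have hα0 : 0 < α := by linarith
  refine iSup₂_le fun h hh => ?_
  rw [← integral_congr_ae (hZ₁.ae_comp_sup_zero_eq hN hα0 hν₁ h),
    ← integral_congr_ae (hZ₂.ae_comp_sup_zero_eq hN hα0 hν₂ h), ← Real.enorm_eq_ofReal_abs]
  -- The coupling depends on `ε`, but its cost bound does not, so `ε` may tend to `0`.
  calc _ ≤ d * (ENNReal.ofReal (α⁻¹ * Real.Gamma (1 - 1 / α)) * tvDist ν₁ ν₂) := by
        refine ge_of_tendsto (x := nhdsWithin (0 : ℝ) (Set.Ioi 0))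
          (f := fun ε => d * (ENNReal.ofReal (α⁻¹ * Real.Gamma (1 - 1 / α)) * tvDist ν₁ ν₂) +
            ENNReal.ofReal (2 * d * ε)) ?_ ?_
        · have hc : Continuous fun ε : ℝ => ENNReal.ofReal (2 * d * ε) :=
            ENNReal.continuous_ofReal.comp (continuous_const.mul continuous_id)
          have ht := hc.tendsto 0
          rw [mul_zero, ENNReal.ofReal_zero] at ht
          simpa using (ht.mono_left nhdsWithin_le_nhds).const_add
            (d * (ENNReal.ofReal (α⁻¹ * Real.Gamma (1 - 1 / α)) * tvDist ν₁ ν₂))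
        · filter_upwards [self_mem_nhdsWithin] with ε hε
          exact enorm_integral_sub_integral_le hN hα ν₁ ν₂ hν₁ hν₂ hZ₁ hZ₂ hh hε
    _ ≤ _ := by
        rw [← mul_assoc, ENNReal.ofReal_mul (Nat.cast_nonneg d), ENNReal.ofReal_natCast]
        gcongr
        have hΓ : 0 < Real.Gamma (1 - 1 / α) :=
          Real.Gamma_pos_of_pos (by rw [sub_pos, div_lt_one hα0]; exact hα)
        -- The coupling yields an extra factor `α⁻¹ ≤ 1`, dropped here.
        exact mul_le_of_le_one_left hΓ.le (inv_le_one_of_one_le₀ hα.le)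

end MaxStable

end

theorem mainTheorem5 {d : ℕ} (N : Seminorm ℝ (Fin d → ℝ)) (hN : MaxStable.IsReferenceNorm N)
    (α : ℝ) (hα : 0 < α)
    (ν₁ ν₂ : Measure (MaxStable.posSphere N)) [IsFiniteMeasure ν₁] [IsFiniteMeasure ν₂]
    (hν₁ : MaxStable.MomentConstraints ν₁) (hν₂ : MaxStable.MomentConstraints ν₂)
    {Ω₁ Ω₂ : Type*} [MeasurableSpace Ω₁] [MeasurableSpace Ω₂]
    (P₁ : Measure Ω₁) (P₂ : Measure Ω₂) [IsProbabilityMeasure P₁] [IsProbabilityMeasure P₂]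
    (Z₁ : Ω₁ → Fin d → ℝ) (Z₂ : Ω₂ → Fin d → ℝ)
    (hZ₁ : MaxStable.IsMS P₁ α ν₁ Z₁) (hZ₂ : MaxStable.IsMS P₂ α ν₂ Z₂) :
    MaxStable.kolmogorovDist P₁ P₂ Z₁ Z₂ ≤ (d : ℝ≥0∞) * MaxStable.tvDist ν₁ ν₂ ∧
    (1 < α →
      (∀ h ∈ MaxStable.lipOne d,
        Integrable (fun ω => h (Z₁ ω)) P₁ ∧ Integrable (fun ω => h (Z₂ ω)) P₂) ∧
      MaxStable.wassersteinDist P₁ P₂ Z₁ Z₂ ≤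
        ENNReal.ofReal (d * Real.Gamma (1 - 1 / α)) * MaxStable.tvDist ν₁ ν₂) := by
  refine ⟨MaxStable.kolmogorovDist_le hN hα ν₁ ν₂ hν₁ hν₂ hZ₁ hZ₂, fun hα1 =>
    ⟨fun h hh => ⟨?_, ?_⟩, MaxStable.wassersteinDist_le hN hα1 ν₁ ν₂ hν₁ hν₂ hZ₁ hZ₂⟩⟩
  · exact (hZ₁.integrable_comp_sup_zero hN hα1 hν₁ hh).congr
      (hZ₁.ae_comp_sup_zero_eq hN hα hν₁ h)
  · exact (hZ₂.integrable_comp_sup_zero hN hα1 hν₂ hh).congr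
      (hZ₂.ae_comp_sup_zero_eq hN hα hν₂ h)
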